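/- All graphs are finite, undirected, without loops or multiple edges, and have at least one vertex (only an open neighbourhood may be empty). For a vertex $x$ of a graph $X$, let $N_X(x)$ denote the subgraph of $X$ induced by the neighbours of $x$ (excluding $x$), and let $X-x$ denote the subgraph induced by the vertices other than $x$. A graph is called $(-1)$-dismantlable if it is a cone, i.e. if it has a vertex adjacent to all its other vertices (the graph with no vertices is not a cone). Recursively, for an integer $k\ge 0$, a vertex $x$ of $X$ is called $k$-dismantlable if $N_X(x)$ is $(k-1)$-dismantlable, and a graph is called $k$-dismantlable if it can be reduced to a single vertex by successively deleting vertices, each of which is $k$-dismantlable in the graph from which it is deleted. For $k\ge 0$, the $k$-homotopy class $[X]_k$ of a graph $X$ is the set of all graphs $Y$ such that one can go from $X$ to $Y$ by a finite succession of moves, each of which is, up to isomorphism, either the deletion of a $k$-dismantlable vertex (passing from $Z$ to $Z-x$ with $x$ a $k$-dismantlable vertex of $Z$) or the addition of one (passing from $Z-x$ to $Z$). Proposition. For every integer $k\ge 1$ and every graph $X$, $[X]_k=[X]_1$. -/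

import Mathlib

universe u

/-- The graph `G` is a cone: some vertex (an apex) is adjacent to all other vertices.
In particular the graph without vertices is not a cone. -/
def IsCone {V : Type u} (G : SimpleGraph V) : Prop :=
  ∃ a : V, ∀ v : V, v ≠ a → G.Adj a v

/-- Given a property `P` of a graph together with one of its vertices, `ReducesToPoint P G` says
that `G` can be reduced to a graph with exactly one vertex by successively deleting vertices,
each of which satisfies `P` in the graph from which it is deleted. -/
inductive ReducesToPoint (P : ∀ {V : Type u}, SimpleGraph V → V → Prop) :
    ∀ {V : Type u}, SimpleGraph V → Prop
  | point {V : Type u} (G : SimpleGraph V) : Nat.card V = 1 → ReducesToPoint P G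
  | delete {V : Type u} (G : SimpleGraph V) (x : V) :
      P G x → ReducesToPoint P (G.induce {x}ᶜ) → ReducesToPoint P G

/-- `DismantlableShift n G` says that the graph `G` is `(n - 1)`-dismantlable:
the `(-1)`-dismantlable graphs are the cones, and a graph is `n`-dismantlable if it can be reduced
to one vertex by successive deletions of `n`-dismantlable vertices, that is, vertices whose open
neighbourhood induces an `(n - 1)`-dismantlable graph. -/
def DismantlableShift : ℕ → ∀ {V : Type u}, SimpleGraph V → Prop
  | 0, _, G => IsCone G
  | n + 1, _, G =>
      ReducesToPoint (fun {_} H x => DismantlableShift n (H.induce (H.neighborSet x))) G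

/-- The vertex `x` of `G` is `k`-dismantlable (`k ≥ 0`): its open neighbourhood is a
`(k - 1)`-dismantlable graph. -/
def IsDismantlableVertex (k : ℕ) {V : Type u} (G : SimpleGraph V) (x : V) : Prop :=
  DismantlableShift k (G.induce (G.neighborSet x))

/-- Finite simple graphs with at least one vertex. -/
structure FinGraph : Type (u + 1) where
  /-- the vertex set -/
  V : Type u
  /-- the adjacency structure -/
  graph : SimpleGraph V
  [finite : Finite V]
  [nonempty : Nonempty V]

namespace FinGraph

/-- `Y` is obtained, up to isomorphism, from `X` by deleting a `k`-dismantlable vertex `x`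
(equivalently, `X` is obtained from `Y` by adding a `k`-dismantlable vertex). -/
def IsDeletion (k : ℕ) (X Y : FinGraph.{u}) : Prop :=
  ∃ x : X.V, IsDismantlableVertex k X.graph x ∧ Nonempty (Y.graph ≃g X.graph.induce {x}ᶜ)

/-- One can go from `X` to `Y` by a (finite) succession of additions or deletions of
`k`-dismantlable vertices. -/
def Homotopic (k : ℕ) (X Y : FinGraph.{u}) : Prop :=
  Relation.ReflTransGen (fun A B => IsDeletion k A B ∨ IsDeletion k B A) X Y

/-- The `k`-homotopy class `[X]_k`: the set of all finite graphs that are `k`-homotopic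
to `X`. -/
def homotopyClass (k : ℕ) (X : FinGraph.{u}) : Set FinGraph.{u} :=
  {Y | Homotopic k X Y}

end FinGraph

-- Since `k`-dismantlability grows with `k`, it suffices to replace each deletion of an
-- `m`-dismantlable vertex by a 1-homotopy, by induction on `m`. The trick is to delete edges
-- instead. If `N(x)` is dismantled in the order `w₁, w₂, …`, remove the edges `x wᵢ` in that order
-- until `x` has one neighbour and can be deleted. At each stage the common neighbours of `x` and
-- `wᵢ` are the neighbourhood of `wᵢ` in what remains of `N(x)`, so they are one level more
-- dismantlable than `N(x)`. `homotopic_deleteEdges` removes such an edge using the induction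
-- hypothesis, after `homotopic_deleteEdges_of_isCone` has treated the cone case by hand.

attribute [instance] FinGraph.finite FinGraph.nonempty

section Dismantlability

/-- Finiteness passes to every stage of the reduction. It is needed because an infinite cone cannot
be reduced to a point. -/
theorem ReducesToPoint.mono_of_finite {P Q : ∀ {V : Type u}, SimpleGraph V → V → Prop}
    (h : ∀ {V : Type u} [Finite V] (G : SimpleGraph V) (x : V), P G x → Q G x)
    {V : Type u} [hV : Finite V] {G : SimpleGraph V} (hG : ReducesToPoint P G) :
    ReducesToPoint Q G := by
  revert hV
  induction hG with
  | point G hc => exact .point G hc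
  | delete G x hx _ ih => exact .delete G x (h G x hx) ih

theorem IsCone.of_card_eq_one {V : Type u} (G : SimpleGraph V) (h : Nat.card V = 1) :
    IsCone G := by
  obtain ⟨hs, ⟨a⟩⟩ := Nat.card_eq_one_iff_unique.1 h
  exact ⟨a, fun v hv => absurd (Subsingleton.elim v a) hv⟩

theorem IsCone.dismantlableShift_one {V : Type u} [Finite V] {G : SimpleGraph V}
    (hG : IsCone G) : DismantlableShift 1 G := by
  induction hn : Nat.card V using Nat.strong_induction_on generalizing V with
  | _ n ih =>
    obtain ⟨a, ha⟩ := hG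
    by_cases hex : ∃ x, x ≠ a
    · obtain ⟨x, hx⟩ := hex
      refine ReducesToPoint.delete G x ?_ ?_
      · refine ⟨⟨a, (ha x hx).symm⟩, fun v hv => ?_⟩
        exact ha v fun h => hv (Subtype.ext h)
      · refine ih (Nat.card ({x}ᶜ : Set V)) ?_ (V := ({x}ᶜ : Set V))
          ⟨⟨a, fun h => hx h.symm⟩, fun v hv => ha v fun h => hv (Subtype.ext h)⟩ rfl
        rw [← hn]
        exact Finite.card_subtype_lt (x := x) (by simp)
    · push Not at hex
      refine ReducesToPoint.point G ?_
      rw [Nat.card_eq_one_iff_unique]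
      exact ⟨⟨fun v w => (hex v).trans (hex w).symm⟩, ⟨a⟩⟩

theorem DismantlableShift.succ {n : ℕ} {V : Type u} [Finite V] {G : SimpleGraph V}
    (hG : DismantlableShift n G) : DismantlableShift (n + 1) G := by
  induction n generalizing V with
  | zero => exact IsCone.dismantlableShift_one hG
  | succ n ih => exact ReducesToPoint.mono_of_finite (fun _ _ h => ih h) hG

theorem DismantlableShift.mono {m n : ℕ} (hmn : m ≤ n) {V : Type u} [Finite V]
    {G : SimpleGraph V} (hG : DismantlableShift m G) : DismantlableShift n G := by
  induction n, hmn using Nat.le_induction with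
  | base => exact hG
  | succ n _ ih => exact ih.succ

theorem IsCone.dismantlableShift {V : Type u} [Finite V] {G : SimpleGraph V}
    (hG : IsCone G) (n : ℕ) : DismantlableShift n G :=
  DismantlableShift.mono (m := 0) n.zero_le hG

/-- A graph which is the join of an `n`-dismantlable graph with any graph is
`n`-dismantlable. -/
theorem DismantlableShift.join {n : ℕ} {W V : Type u} [Finite V] {H : SimpleGraph W}
    {G : SimpleGraph V} (hH : DismantlableShift n H) (f : H ↪g G)
    (hf : ∀ v, v ∉ Set.range f → ∀ w, G.Adj v (f w)) : DismantlableShift n G := by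
  induction n generalizing W V with
  | zero =>
    obtain ⟨a, ha⟩ := hH
    refine ⟨f a, fun v hv => ?_⟩
    by_cases h : v ∈ Set.range f
    · obtain ⟨w, rfl⟩ := h
      exact f.map_rel_iff.2 (ha w fun h => hv (h ▸ rfl))
    · exact (hf v h a).symm
  | succ n ihn =>
    change ReducesToPoint _ H at hH
    induction hH generalizing V with
    | point H hc =>
      obtain ⟨hs, ⟨a⟩⟩ := Nat.card_eq_one_iff_unique.1 hc
      refine IsCone.dismantlableShift ⟨f a, fun v hv => (hf v ?_ a).symm⟩ _
      rintro ⟨w, rfl⟩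
      exact hv (congrArg f (Subsingleton.elim w a))
    | delete H x hx _ ih =>
      -- The dismantling of `H` is carried out inside `G`: both the neighbourhood of `f x` and the
      -- remainder are again joins with the vertices outside `f`.
      refine ReducesToPoint.delete G (f x) ?_ ?_
      · refine ihn hx ⟨⟨fun w => ⟨f w.1, f.map_rel_iff.2 w.2⟩, fun w w' h =>
          Subtype.ext (f.injective (congrArg Subtype.val h))⟩, f.map_rel_iff⟩ ?_
        rintro ⟨v, hv⟩ hvr ⟨w, hw⟩
        refine hf v ?_ w
        rintro ⟨w', rfl⟩
        exact hvr ⟨⟨w', f.map_rel_iff.1 hv⟩, rfl⟩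
      · refine ih ⟨⟨fun w => ⟨f w.1, fun h => w.2 (f.injective h)⟩, fun w w' h =>
          Subtype.ext (f.injective (congrArg Subtype.val h))⟩, f.map_rel_iff⟩ ?_
        rintro ⟨v, hv⟩ hvr ⟨w, hw⟩
        refine hf v ?_ w
        rintro ⟨w', rfl⟩
        exact hvr ⟨⟨w', fun h => hv (congrArg f h)⟩, rfl⟩

theorem DismantlableShift.of_surjective {n : ℕ} {W V : Type u} [Finite V] {H : SimpleGraph W}
    {G : SimpleGraph V} (hH : DismantlableShift n H) (f : H ↪g G)
    (hf : Function.Surjective f) : DismantlableShift n G :=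
  hH.join f fun v hv => absurd (hf v) hv

end Dismantlability

namespace SimpleGraph

/-- The graph obtained from `G` by adding the vertex `none`, with the set `s` of neighbours. -/
def addVertex {V : Type u} (G : SimpleGraph V) (s : Set V) : SimpleGraph (Option V) where
  Adj
    | none, none => False
    | none, some v => v ∈ s
    | some v, none => v ∈ s
    | some v, some w => G.Adj v w
  symm := ⟨by rintro (_ | v) (_ | w) h <;> first | exact h | exact G.symm.symm _ _ h⟩
  loopless := ⟨by rintro (_ | v) h <;> first | exact h | exact G.loopless.irrefl v h⟩

variable {V : Type u} (G : SimpleGraph V) (s : Set V)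

@[simp] theorem addVertex_none_none : ¬ (G.addVertex s).Adj none none := id

@[simp] theorem addVertex_none_some (v : V) : (G.addVertex s).Adj none (some v) ↔ v ∈ s := .rfl

@[simp] theorem addVertex_some_none (v : V) : (G.addVertex s).Adj (some v) none ↔ v ∈ s := .rfl

@[simp] theorem addVertex_some_some (v w : V) :
    (G.addVertex s).Adj (some v) (some w) ↔ G.Adj v w := .rfl

/-- An embedding whose range misses exactly `x` identifies its domain with the graph
obtained by deleting `x`. -/
noncomputable def Embedding.isoInduceCompl {V W : Type u} {G : SimpleGraph V}
    {H : SimpleGraph W} (f : H ↪g G) (x : V) (hf : Set.range f = {x}ᶜ) :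
    H ≃g G.induce {x}ᶜ where
  toEquiv := (Equiv.ofInjective f f.injective).trans (Equiv.setCongr hf)
  map_rel_iff' := f.map_rel_iff

end SimpleGraph

namespace FinGraph

theorem Homotopic.symm {k : ℕ} {X Y : FinGraph.{u}} (h : Homotopic k X Y) : Homotopic k Y X := by
  induction h with
  | refl => exact .refl
  | tail _ hs ih => exact .head hs.symm ih

theorem IsDeletion.homotopic {k : ℕ} {X Y : FinGraph.{u}} (h : IsDeletion k X Y) :
    Homotopic k X Y :=
  .single (.inl h)

theorem IsDeletion.mono {k l : ℕ} (hkl : k ≤ l) {X Y : FinGraph.{u}} (h : IsDeletion k X Y) :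
    IsDeletion l X Y :=
  let ⟨x, hx, e⟩ := h
  ⟨x, DismantlableShift.mono hkl hx, e⟩

theorem Homotopic.of_isDeletion {k l : ℕ}
    (h : ∀ X Y : FinGraph.{u}, IsDeletion k X Y → Homotopic l X Y)
    {X Y : FinGraph.{u}} (hXY : Homotopic k X Y) : Homotopic l X Y := by
  induction hXY with
  | refl => exact .refl
  | tail _ hs ih => exact ih.trans (hs.elim (h _ _) fun hs => (h _ _ hs).symm)

theorem IsDeletion.of_embedding {k : ℕ} {V W : Type u} [Finite V] [Nonempty V] [Finite W]
    [Nonempty W] {G : SimpleGraph V} {H : SimpleGraph W} {x : V}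
    (hx : IsDismantlableVertex k G x) (f : H ↪g G) (hf : Set.range f = {x}ᶜ) :
    IsDeletion k ⟨V, G⟩ ⟨W, H⟩ :=
  ⟨x, hx, ⟨f.isoInduceCompl x hf⟩⟩

variable {V : Type u} [Finite V] [Nonempty V] {G : SimpleGraph V}

theorem isDeletion_addVertex {k : ℕ} {s : Set V}
    (hs : IsDismantlableVertex k (G.addVertex s) none) :
    IsDeletion k ⟨Option V, G.addVertex s⟩ ⟨V, G⟩ :=
  .of_embedding hs ⟨⟨some, Option.some_injective V⟩, .rfl⟩ (by
    ext (_ | v)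
    · exact ⟨fun ⟨_, h⟩ => (Option.some_ne_none _ h).elim, fun h => absurd rfl h⟩
    · exact ⟨fun _ => Option.some_ne_none v, fun _ => ⟨v, rfl⟩⟩)

open Classical in
/-- An edge whose ends have common neighbours forming a cone can be deleted up to
`1`-homotopy. -/
theorem homotopic_deleteEdges_of_isCone {x y : V} (hxy : G.Adj x y)
    (hc : IsCone (G.induce {v | G.Adj x v ∧ G.Adj y v})) :
    Homotopic 1 ⟨V, G⟩ ⟨V, G.deleteEdges {s(x, y)}⟩ := by
  -- The new vertex is a twin of `y` not joined to `x`; deleting `y` then lets it play the role of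
  -- `y` without the edge.
  set s : Set V := {v | v = y ∨ G.Adj y v ∧ v ≠ x} with hs
  have hne : x ≠ y := hxy.ne
  refine Relation.ReflTransGen.trans (b := (⟨Option V, G.addVertex s⟩ : FinGraph))
    (IsDeletion.homotopic ?_).symm (IsDeletion.homotopic ?_)
  · refine isDeletion_addVertex (IsCone.dismantlableShift ?_ 1)
    refine ⟨⟨some y, Or.inl rfl⟩, ?_⟩
    rintro ⟨_ | v, hv⟩ h
    · exact hv.elim
    · rcases hv with rfl | hv
      · exact absurd rfl h
      · exact hv.1
  · refine IsDeletion.of_embedding (x := some y) ?_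
      ⟨⟨fun v => if v = y then none else some v, ?_⟩, ?_⟩ ?_
    · refine ReducesToPoint.delete _ ⟨some x, hxy.symm⟩ ?_ (IsCone.dismantlableShift_one ?_)
      · refine DismantlableShift.of_surjective (n := 0) hc
          ⟨⟨fun v => ⟨⟨some v.1, v.2.2⟩, v.2.1⟩, ?_⟩, .rfl⟩ ?_
        · intro v w h
          simpa [Subtype.ext_iff] using h
        · rintro ⟨⟨_ | v, hv⟩, hv'⟩
          · exact absurd hv' (by simp [hs, hne])
          · exact ⟨⟨v, hv', hv⟩, rfl⟩
      · refine ⟨⟨⟨none, Or.inl rfl⟩, fun h => Option.some_ne_none x (congrArg Subtype.val h).symm⟩, ?_⟩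
        rintro ⟨⟨_ | v, hv⟩, hv'⟩ h
        · exact absurd rfl h
        · refine Or.inr ⟨hv, ?_⟩
          rintro rfl
          exact hv' rfl
    · intro v w h
      dsimp only at h
      split_ifs at h with h1 h2 h2
      · exact h1.trans h2.symm
      · exact Option.some_injective V h
    · intro v w
      change (G.addVertex s).Adj (if v = y then none else some v)
        (if w = y then none else some w) ↔ _
      by_cases hv : v = y <;> by_cases hw : w = y
      · simp [hv, hw]
      · subst hv
        simp [hw, hs, SimpleGraph.deleteEdges_adj, hne.symm]
      · subst hw
        simp [hv, hs, SimpleGraph.deleteEdges_adj, hne.symm, G.adj_comm v]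
      · simp [hv, hw, SimpleGraph.deleteEdges_adj]
    · change (Set.range fun v => if v = y then none else some v) = _
      ext (_ | v)
      · simp
      · simp only [Set.mem_range, Set.mem_compl_iff, Set.mem_singleton_iff, Option.some.injEq]
        refine ⟨?_, fun h => ⟨v, if_neg h⟩⟩
        rintro ⟨w, hw⟩ rfl
        split_ifs at hw with h
        exact h (Option.some_injective V hw)

/-- If vertices with neighbourhoods of a given dismantlability can be deleted up to
`1`-homotopy, so can edges whose ends have common neighbours of that dismantlability. -/
theorem homotopic_deleteEdges {m : ℕ}
    (hm : ∀ X Y : FinGraph.{u}, IsDeletion m X Y → Homotopic 1 X Y) {x y : V}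
    (hxy : G.Adj x y) (hc : DismantlableShift m (G.induce {v | G.Adj x v ∧ G.Adj y v})) :
    Homotopic 1 ⟨V, G⟩ ⟨V, G.deleteEdges {s(x, y)}⟩ := by
  -- The new vertex is an apex over the common neighbours of `x` and `y`, so the cone case removes
  -- the edge. Its own neighbourhood is then the join of the old common neighbours with `{x, y}`, so
  -- `hm` deletes it.
  set s : Set V := {v | v = x ∨ v = y ∨ (G.Adj x v ∧ G.Adj y v)} with hs
  have hne : x ≠ y := hxy.ne
  refine Relation.ReflTransGen.trans (b := (⟨Option V, G.addVertex s⟩ : FinGraph))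
    (IsDeletion.homotopic (isDeletion_addVertex (IsCone.dismantlableShift ?_ 1))).symm
    (Relation.ReflTransGen.trans
      (b := (⟨Option V, (G.addVertex s).deleteEdges {s(some x, some y)}⟩ : FinGraph))
      (homotopic_deleteEdges_of_isCone hxy ?_) (hm _ _ ?_))
  · refine ⟨⟨some x, Or.inl rfl⟩, ?_⟩
    rintro ⟨_ | v, hv⟩ h
    · exact hv.elim
    · rcases hv with rfl | rfl | hv
      · exact absurd rfl h
      · exact hxy
      · exact hv.1
  · refine ⟨⟨none, Or.inl rfl, Or.inr (Or.inl rfl)⟩, ?_⟩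
    rintro ⟨_ | v, hv⟩ h
    · exact absurd rfl h
    · exact Or.inr (Or.inr hv)
  · have hE : (G.addVertex s).deleteEdges {s(some x, some y)} =
        (G.deleteEdges {s(x, y)}).addVertex s := by
      ext (_ | v) (_ | w) <;> simp [SimpleGraph.deleteEdges_adj]
    rw [hE]
    refine isDeletion_addVertex (DismantlableShift.join hc
      ⟨⟨fun v => ⟨some v.1, Or.inr (Or.inr v.2)⟩, ?_⟩, ?_⟩ ?_)
    · intro v w h
      simpa [Subtype.ext_iff] using h
    · rintro ⟨v, hv⟩ ⟨w, hw⟩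
      have h1 := hv.1.ne
      have h2 := hv.2.ne
      change (G.deleteEdges {s(x, y)}).Adj v w ↔ G.Adj v w
      simp [SimpleGraph.deleteEdges_adj, h1.symm, h2.symm]
    · rintro ⟨_ | v, hv⟩ hr ⟨w, hw⟩
      · exact hv.elim
      · have h1 := hw.1.ne
        have h2 := hw.2.ne
        change (G.deleteEdges {s(x, y)}).Adj v w
        rcases hv with rfl | rfl | hv
        · simpa [SimpleGraph.deleteEdges_adj, h1.symm, h2.symm, hne] using hw.1
        · simpa [SimpleGraph.deleteEdges_adj, h1.symm, h2.symm, hne.symm] using hw.2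
        · exact absurd ⟨⟨v, hv⟩, rfl⟩ hr

/-- If vertices with neighbourhoods of a given dismantlability can be deleted up to
`1`-homotopy, so can those with neighbourhoods of the next dismantlability: delete the edges
to the neighbours one after the other. -/
theorem homotopic_of_isDeletion_succ {m : ℕ}
    (hm : ∀ X Y : FinGraph.{u}, IsDeletion m X Y → Homotopic 1 X Y)
    (X Y : FinGraph.{u}) (h : IsDeletion (m + 1) X Y) : Homotopic 1 X Y := by
  -- The neighbourhood is replaced by an abstract `H` so that the induction can follow its
  -- dismantling while `G` loses edges and `Y` stays fixed.
  suffices key : ∀ {W : Type u} (H : SimpleGraph W),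
      ReducesToPoint
        (fun {_} H x => DismantlableShift m (H.induce (H.neighborSet x))) H →
      ∀ {V : Type u} [Finite V] [Nonempty V] (G : SimpleGraph V) (x : V) (f : H ↪g G),
        Set.range f = G.neighborSet x → Nonempty (Y.graph ≃g G.induce {x}ᶜ) →
        Homotopic 1 ⟨V, G⟩ Y by
    obtain ⟨x, hx, e⟩ := h
    exact key _ hx X.graph x (SimpleGraph.Embedding.induce _) (by ext; simp) e
  clear h X
  intro W H hH
  induction hH with
  | point H hc =>
    intro V _ _ G x f hf e
    refine IsDeletion.homotopic ⟨x, IsCone.dismantlableShift (.of_card_eq_one _ ?_) 1, e⟩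
    rw [← hc, ← hf]
    exact (Nat.card_congr (Equiv.ofInjective f f.injective)).symm
  | delete H w hw _ ih =>
    intro V _ _ G x f hf e
    have hadj : ∀ w, G.Adj x (f w) := fun w => by
      rw [← SimpleGraph.mem_neighborSet, ← hf]
      exact ⟨w, rfl⟩
    refine (homotopic_deleteEdges hm (hadj w) ?_).trans
      (ih (G.deleteEdges {s(x, f w)}) x
        ⟨⟨fun v => f v.1, fun v v' h => Subtype.ext (f.injective h)⟩, ?_⟩ ?_ ?_)
    · refine hw.of_surjective ⟨⟨fun v => ⟨f v.1, hadj _, f.map_rel_iff.2 v.2⟩, fun v v' h =>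
          Subtype.ext (f.injective (congrArg Subtype.val h))⟩, f.map_rel_iff⟩ ?_
      rintro ⟨v, hv, hv'⟩
      obtain ⟨u, rfl⟩ : v ∈ Set.range f := hf ▸ hv
      exact ⟨⟨u, f.map_rel_iff.1 hv'⟩, rfl⟩
    · intro v v'
      have h1 := (hadj v).ne
      have h2 := (hadj v').ne
      change (G.deleteEdges {s(x, f w)}).Adj (f v) (f v') ↔ H.Adj v v'
      simp [SimpleGraph.deleteEdges_adj, h1.symm, h2.symm]
    · ext v
      have := Set.ext_iff.1 hf v
      simp only [Set.mem_range, SimpleGraph.mem_neighborSet] at this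
      rw [SimpleGraph.mem_neighborSet, SimpleGraph.deleteEdges_adj, ← this]
      constructor
      · rintro ⟨u, rfl⟩
        refine ⟨⟨u, rfl⟩, ?_⟩
        have h1 := (hadj w).ne
        have h2 : f u.1 ≠ f w := fun h => u.2 (f.injective h)
        change s(x, f u.1) ∉ _
        simp [h1, h2]
      · rintro ⟨⟨u, rfl⟩, hu⟩
        refine ⟨⟨u, ?_⟩, rfl⟩
        rintro rfl
        exact hu rfl
    · have hE : (G.deleteEdges {s(x, f w)}).induce {x}ᶜ = G.induce {x}ᶜ := by
        ext ⟨a, ha⟩ ⟨b, hb⟩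
        have ha : a ≠ x := ha
        have hb : b ≠ x := hb
        simp [SimpleGraph.deleteEdges_adj, ha, hb]
      rw [hE]
      exact e

theorem homotopic_one_of_isDeletion (m : ℕ) (X Y : FinGraph.{u}) (h : IsDeletion m X Y) :
    Homotopic 1 X Y := by
  induction m generalizing X Y with
  | zero => exact (h.mono zero_le_one).homotopic
  | succ m ih => exact homotopic_of_isDeletion_succ ih X Y h

end FinGraph

theorem proposition5 (k : ℕ) (hk : 1 ≤ k) (X : FinGraph.{u}) :
    FinGraph.homotopyClass k X = FinGraph.homotopyClass 1 X := by
  ext Y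
  exact ⟨.of_isDeletion (FinGraph.homotopic_one_of_isDeletion k),
    .of_isDeletion fun _ _ h => (h.mono hk).homotopic⟩
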